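/- Consider an asynchronous system of $n$ processes that communicate through non-volatile shared memory. Processes may crash and recover individually, at any time and arbitrarily often (independent crashes). A crash does not change shared memory, but resets the local memory of the process, including its program counter, so that upon recovery the process executes its code again from the beginning, with the same input. An algorithm solves \emph{recoverable consensus} (RC) among $n$ processes if each process, given an input value from an arbitrary set, executes a routine such that in every execution: (agreement) no two output values are different, including outputs of the same process in different runs of its code; (validity) each output is the input of some process; (recoverable wait-freedom) every process that executes its routine from the beginning crashes or outputs a value after a finite number of its own steps. An object type $T$ is \emph{deterministic} if each operation applied in each state has a unique response and a unique resulting state, and it is \emph{readable} if it has an operation that returns the entire state of the object without changing it. Given a state $q_0$, operations $op_1,\dots,op_n$ of $T$ and $X\subseteq\{1,\dots,n\}$, let $Q_X$ be the set of all states to which an object is taken from $q_0$ by a sequence of operations $op_{i_1},\dots,op_{i_\alpha}$ with $\alpha\ge 1$, distinct indices $i_1,\dots,i_\alpha$ and $i_1\in X$. The type $T$ is \emph{$n$-recording} if there are a state $q_0$, a partition of $\{1,\dots,n\}$ into two non-empty sets $A$ and $B$, and operations $op_1,\dots,op_n$ such that (1) $Q_A\cap Q_B=\emptyset$; (2) $q_0\notin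 Q_A$ or $|B|=1$; (3) $q_0\notin Q_B$ or $|A|=1$. \textbf{Theorem.} If a deterministic, readable type $T$ is $n$-recording, then objects of type $T$ (as many as desired, with initial states chosen by the algorithm), together with read/write registers, can be used to solve recoverable consensus among $n$ processes with independent crashes. -/

import Mathlib

universe u v

/-- A deterministic shared object type, given by its sequential specification: applying an
operation (name and arguments together) in a state yields a unique new state and response. -/
structure DetObjectType where
  State : Type u
  Op : Type u
  Resp : Type u
  apply : State → Op → State × Resp

namespace DetObjectType

/-- The type has a read operation, which leaves every state unchanged and whose response
determines the entire state (the response is the state, encoded as an element of `Resp`). -/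
def IsReadable (T : DetObjectType.{u}) : Prop :=
  ∃ (rd : T.Op) (enc : T.State → T.Resp),
    Function.Injective enc ∧ ∀ q, T.apply q rd = (q, enc q)

/-- The state reached from `q` by performing a list of operations, from left to right. -/
def stateAfter (T : DetObjectType.{u}) (q : T.State) (ops : List T.Op) : T.State :=
  ops.foldl (fun s o => (T.apply s o).1) q

/-- `Q_X(q₀, op₁, …, opₙ)`: the states reached from `q₀` by performing, in some order, the
operations of distinct indices, at least one of them, with the first index in `X`. -/
def firstBy (T : DetObjectType.{u}) {n : ℕ} (q₀ : T.State) (op : Fin n → T.Op)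
    (X : Finset (Fin n)) : Set T.State :=
  {q | ∃ (i : Fin n) (l : List (Fin n)), i ∈ X ∧ (i :: l).Nodup ∧
    T.stateAfter q₀ ((i :: l).map op) = q}

/-- The `n`-recording property. -/
def IsRecording (T : DetObjectType.{u}) (n : ℕ) : Prop :=
  ∃ (q₀ : T.State) (A B : Finset (Fin n)) (op : Fin n → T.Op),
    A.Nonempty ∧ B.Nonempty ∧ Disjoint A B ∧ A ∪ B = Finset.univ ∧
    T.firstBy q₀ op A ∩ T.firstBy q₀ op B = ∅ ∧
    (q₀ ∉ T.firstBy q₀ op A ∨ B.card = 1) ∧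
    (q₀ ∉ T.firstBy q₀ op B ∨ A.card = 1)

end DetObjectType

/-- What a process does next, as a function of its local state: it has returned the value `a`,
or it is about to perform one atomic access to shared memory (an operation on an object of type
`T`, a read of a register or a write to a register). The continuation gives the
local state after the access, as a function of the response. -/
inductive NextAction (T : DetObjectType.{u}) (V : Type v) (Obj Reg : Type)
    (W L : Type (max u v)) : Type (max u v)
  | output (a : V)
  | invoke (o : Obj) (op : T.Op) (k : T.Resp → L)
  | read (r : Reg) (k : W → L)
  | write (r : Reg) (w : W) (k : L)

/-- An algorithm for `n` processes with inputs and outputs in `V`, using objects of type `T` and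
read/write registers. The numbers of objects and of registers may be infinite. The initial states
of the objects and registers are fixed by the algorithm and do not depend on the inputs. A process
starts in a local state that depends on its index and its own input only. -/
structure Algorithm (T : DetObjectType.{u}) (n : ℕ) (V : Type v) where
  /-- the names of the objects of type `T` -/
  Obj : Type
  /-- the names of the registers -/
  Reg : Type
  /-- the values that a register can hold -/
  W : Type (max u v)
  /-- the local states of the processes -/
  L : Type (max u v)
  objInit : Obj → T.State
  regInit : Reg → W
  start : Fin n → V → L
  next : Fin n → L → NextAction T V Obj Reg W L

/-- An event of an execution: a process takes its next step, or it crashes (individually) and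
recovers. A process that crashes and never recovers just has no later event. -/
inductive Event (n : ℕ)
  | step (i : Fin n)
  | crash (i : Fin n)

namespace Algorithm

variable {T : DetObjectType.{u}} {n : ℕ} {V : Type v}

/-- A configuration: the (volatile) local states and the (non-volatile) shared memory. -/
structure Config (P : Algorithm T n V) where
  loc : Fin n → P.L
  obj : P.Obj → T.State
  reg : P.Reg → P.W

/-- The initial configuration when process `i` has the input `x i`. -/
def initial (P : Algorithm T n V) (x : Fin n → V) : P.Config where
  loc i := P.start i (x i)
  obj := P.objInit
  reg := P.regInit

open Classical in
/-- The effect of an event. A crash puts the local state of the process back to its initial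
value, with the same input, and leaves the shared memory unchanged. A process that has returned a
value does nothing any more, unless it crashes. -/
noncomputable def after (P : Algorithm T n V) (x : Fin n → V) (c : P.Config) :
    Event n → P.Config
  | .crash i => { c with loc := Function.update c.loc i (P.start i (x i)) }
  | .step i =>
    match P.next i (c.loc i) with
    | .output _ => c
    | .invoke o op k =>
      { c with
        loc := Function.update c.loc i (k (T.apply (c.obj o) op).2)
        obj := Function.update c.obj o (T.apply (c.obj o) op).1 }
    | .read r k => { c with loc := Function.update c.loc i (k (c.reg r)) }
    | .write r w k =>
      { c with
        loc := Function.update c.loc i k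
        reg := Function.update c.reg r w }

/-- The configuration after the first `t` events of the schedule `σ`, with inputs `x`. Every
interleaving of steps and individual crashes is a schedule; every finite execution is an initial
part of one. -/
noncomputable def configAt (P : Algorithm T n V) (x : Fin n → V) (σ : ℕ → Event n) :
    ℕ → P.Config
  | 0 => P.initial x
  | t + 1 => P.after x (P.configAt x σ t) (σ t)

/-- In the configuration `c`, the current run of process `i` has returned the value `a`. -/
def Outputs (P : Algorithm T n V) (c : P.Config) (i : Fin n) (a : V) : Prop :=
  P.next i (c.loc i) = .output a

/-- No two outputs in an execution differ, be they by different processes or by several runs of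
the same process. -/
def Agreement (P : Algorithm T n V) : Prop :=
  ∀ (x : Fin n → V) (σ : ℕ → Event n) (s t : ℕ) (i j : Fin n) (a b : V),
    P.Outputs (P.configAt x σ s) i a → P.Outputs (P.configAt x σ t) j b → a = b

/-- Every output is the input of some process. -/
def Validity (P : Algorithm T n V) : Prop :=
  ∀ (x : Fin n → V) (σ : ℕ → Event n) (t : ℕ) (i : Fin n) (a : V),
    P.Outputs (P.configAt x σ t) i a → ∃ j, x j = a

/-- Recoverable wait-freedom: every run of every process crashes or returns a value after
finitely many steps of the process. That is, a process that is scheduled to take infinitely many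
steps crashes or has returned, at or after any given time. -/
def RecoverableWaitFree (P : Algorithm T n V) : Prop :=
  ∀ (x : Fin n → V) (σ : ℕ → Event n) (i : Fin n),
    (∀ t, ∃ s, t ≤ s ∧ σ s = .step i) →
    ∀ t, ∃ s, t ≤ s ∧ (σ s = .crash i ∨ ∃ a, P.Outputs (P.configAt x σ s) i a)

/-- The algorithm solves recoverable consensus, with independent crashes. -/
def SolvesRC (P : Algorithm T n V) : Prop :=
  P.Agreement ∧ P.Validity ∧ P.RecoverableWaitFree

end Algorithm

/-- Objects of type `T` together with registers solve recoverable consensus among `n` processes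
with independent crashes, for inputs from an arbitrary set. -/
def RCSolvable (T : DetObjectType.{u}) (n : ℕ) : Prop :=
  ∀ V : Type v, ∃ P : Algorithm T n V, P.SolvesRC

/-! ### Recording witnesses and permutations of the processes. -/

namespace DetObjectType

/-! The processes play a knockout tournament. A group with at least two members is split into its
two teams, and by `card_group_self` the groups of level `n` have at most one member; a process
climbs from its input at level `n` to the outcome of the root. In a contest all members of a team
carry the same value, the outcome of their subgroup, and announce it. As `Q true` and `Q false` are
disjoint, the state of the object reveals the team that moved first, and the value of that team is
passed on.

A crashed process must not apply its operation twice in one sequence. It applies it only after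
seeing the initial state, so trouble arises only if the object returns to that state. By
`of_stateAfter_eq_init` this needs a start by the team `true` and a move of every member of the team
`false`, and then by `solo` that team is a single process. This process yields whenever it sees an
announcement of the team `true`, so after a return only the team `true` moves, and the state remains
in `Q true`.

The invariant `Inv`, kept by `Inv.after`, records this with an auxiliary history: the moves since
the last initial state, which are free of repetitions, and a flag that the team `true` has won for
good. Wins and announced values persist and outcomes are unique (`Inv.decided_unique`), whence
agreement. Validity and termination need only `after_step_spec`. -/

/-- A recording witness, relabelled for every group `S` of processes so that both teams occur in
`S`, and normalised so that the initial state is not reachable by a sequence that the team `false`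
starts; `Q b` contains the states reached by sequences that the team `b` starts. -/
structure TeamScheme (T : DetObjectType.{u}) (n : ℕ) where
  init : T.State
  Q : Bool → Set T.State
  team : Finset (Fin n) → Fin n → Bool
  op : Finset (Fin n) → Fin n → T.Op
  mem_Q : ∀ S i l, (i :: l).Nodup → T.stateAfter init ((i :: l).map (op S)) ∈ Q (team S i)
  not_mem_both : ∀ q, q ∈ Q true → q ∉ Q false
  init_not_mem : init ∉ Q false
  solo : init ∈ Q true → ∀ S i j, team S i = false → team S j = false → i = j
  splits : ∀ S : Finset (Fin n), 2 ≤ S.card → ∀ b, ∃ i ∈ S, team S i = b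

theorem stateAfter_append (T : DetObjectType.{u}) (q : T.State) (l l' : List T.Op) :
    T.stateAfter q (l ++ l') = T.stateAfter (T.stateAfter q l) l' := by
  simp [stateAfter]

/-- A permutation that sends two given distinct points to two given distinct points. -/
theorem exists_perm_map_pair {α : Type*} [DecidableEq α] {s t a b : α} (hst : s ≠ t)
    (hab : a ≠ b) : ∃ f : Equiv.Perm α, f s = a ∧ f t = b := by
  refine ⟨Equiv.swap (Equiv.swap s a t) b * Equiv.swap s a, ?_, ?_⟩
  · have h : a ≠ Equiv.swap s a t := by
      intro h
      apply hst
      apply (Equiv.swap s a).injective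
      rw [Equiv.swap_apply_left, ← h]
    simp [Equiv.swap_apply_of_ne_of_ne h hab]
  · simp

/-- Leaving out operations only shrinks the sets of reachable states, so one witness serves every
group; it only has to be permuted so that two members of the group land in different teams. -/
theorem IsRecording.exists_teamScheme {T : DetObjectType.{u}} {n : ℕ} (h : T.IsRecording n) :
    Nonempty (T.TeamScheme n) := by
  classical
  have key : ∃ (q₀ : T.State) (A B : Finset (Fin n)) (op : Fin n → T.Op),
      A.Nonempty ∧ B.Nonempty ∧ Disjoint A B ∧ A ∪ B = Finset.univ ∧
      T.firstBy q₀ op A ∩ T.firstBy q₀ op B = ∅ ∧ q₀ ∉ T.firstBy q₀ op B ∧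
      (q₀ ∉ T.firstBy q₀ op A ∨ B.card = 1) := by
    obtain ⟨q₀, A, B, op, hA, hB, hd, hu, hi, h1, h2⟩ := h
    -- If the team `B` can restore `q₀`, disjointness forbids it to `A`, and exchanging the names of
    -- the teams gives the normal form.
    by_cases hq : q₀ ∈ T.firstBy q₀ op B
    · refine ⟨q₀, B, A, op, hB, hA, hd.symm, by rw [Finset.union_comm, hu],
        by rw [Set.inter_comm, hi], fun hq' => ?_, h2⟩
      have : q₀ ∈ T.firstBy q₀ op A ∩ T.firstBy q₀ op B := ⟨hq', hq⟩
      simp [hi] at this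
    · exact ⟨q₀, A, B, op, hA, hB, hd, hu, hi, hq, h1⟩
  obtain ⟨q₀, A, B, op, ⟨a, ha⟩, ⟨b, hb⟩, hd, hu, hi, hq, h1⟩ := key
  have hab : a ≠ b := fun e => Finset.disjoint_left.1 hd ha (e ▸ hb)
  have hnA : ∀ i, i ∉ A → i ∈ B := fun i hiA => by
    have := Finset.mem_univ i
    rw [← hu, Finset.mem_union] at this
    exact this.resolve_left hiA
  have hperm : ∀ S : Finset (Fin n), ∃ f : Equiv.Perm (Fin n),
      2 ≤ S.card → ∃ s ∈ S, ∃ t ∈ S, f s = a ∧ f t = b := by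
    intro S
    by_cases hS : 2 ≤ S.card
    · obtain ⟨s, hs, t, ht, hst⟩ := Finset.one_lt_card.1 hS
      obtain ⟨f, hf⟩ := exists_perm_map_pair hst hab
      exact ⟨f, fun _ => ⟨s, hs, t, ht, hf⟩⟩
    · exact ⟨1, fun h => absurd h hS⟩
  choose f hf using hperm
  refine ⟨{
    init := q₀
    Q := fun c => T.firstBy q₀ op (if c then A else B)
    team := fun S i => decide (f S i ∈ A)
    op := fun S i => op (f S i)
    mem_Q := ?_
    not_mem_both := ?_
    init_not_mem := by simpa using hq
    solo := ?_
    splits := ?_ }⟩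
  · intro S i l hl
    refine ⟨f S i, l.map (f S), ?_, ?_, ?_⟩
    · by_cases hiA : f S i ∈ A
      · simp [hiA]
      · simpa [hiA] using hnA _ hiA
    · simpa using hl.map (f S).injective
    · simp [Function.comp_def]
  · intro q hqA hqB
    have : q ∈ T.firstBy q₀ op A ∩ T.firstBy q₀ op B := ⟨by simpa using hqA, by simpa using hqB⟩
    simp [hi] at this
  · intro hq0 S i j hi' hj'
    have hcard := h1.resolve_left (fun h => h (by simpa using hq0))
    obtain ⟨c, rfl⟩ := Finset.card_eq_one.1 hcard
    have h3 := hnA (f S i) (by simpa using hi')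
    have h4 := hnA (f S j) (by simpa using hj')
    rw [Finset.mem_singleton] at h3 h4
    exact (f S).injective (h3.trans h4.symm)
  · intro S hS c
    obtain ⟨s, hs, t, ht, hfs, hft⟩ := hf S hS
    cases c
    · exact ⟨t, ht, by simp [hft, Finset.disjoint_right.1 hd hb]⟩
    · exact ⟨s, hs, by simp [hfs, ha]⟩

/-! ### Returns to the initial state, and the tree of groups. -/

namespace TeamScheme

variable {T : DetObjectType.{u}} {n : ℕ} (M : T.TeamScheme n)

/-- The sequences that bring the object back to its initial state are started by the team `true`
and contain the operations of all members of the team `false`. -/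
theorem of_stateAfter_eq_init {S : Finset (Fin n)} {i : Fin n} {l : List (Fin n)}
    (hl : (i :: l).Nodup) (h : T.stateAfter M.init ((i :: l).map (M.op S)) = M.init) :
    M.team S i = true ∧ ∀ b, M.team S b = false → b ∈ i :: l := by
  have hQ := M.mem_Q S i l hl
  have hi : M.team S i = true := by
    by_contra hi
    rw [Bool.not_eq_true] at hi
    rw [h, hi] at hQ
    exact M.init_not_mem hQ
  refine ⟨hi, fun b hb => ?_⟩
  by_contra hbl
  -- If `b` has not moved, its operation after the return leads to the same state as its operation
  -- alone; this state would be in both `Q true` and `Q false`.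
  have h1 : (i :: (l ++ [b])).Nodup := by
    rw [← List.cons_append]
    exact List.Nodup.append hl (List.nodup_singleton b) (by simpa using hbl)
  have h2 := M.mem_Q S i (l ++ [b]) h1
  have h3 := M.mem_Q S b [] (List.nodup_singleton b)
  rw [← List.cons_append, List.map_append, stateAfter_append, h, hi] at h2
  rw [hb] at h3
  exact M.not_mem_both _ h2 h3

/-- The part of the group `S` that plays in the team `b`; a group with less than two members is
not split. -/
def subgroup (S : Finset (Fin n)) (b : Bool) : Finset (Fin n) :=
  if 2 ≤ S.card then S.filter (fun i => M.team S i = b) else S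

/-- The group to which process `i` belongs at the level `k` of the tournament. -/
def group (i : Fin n) : ℕ → Finset (Fin n)
  | 0 => Finset.univ
  | k + 1 => M.subgroup (group i k) (M.team (group i k) i)

theorem mem_group (i : Fin n) : ∀ k, i ∈ M.group i k
  | 0 => Finset.mem_univ i
  | k + 1 => by
    have := mem_group i k
    unfold group subgroup
    split_ifs <;> simp [this]

/-- Both teams occur in a group that is split, so each split removes at least one process. -/
theorem card_group (i : Fin n) : ∀ k, (M.group i k).card < 2 ∨ (M.group i k).card + k ≤ n
  | 0 => by simp [group]
  | k + 1 => by
    by_cases h : 2 ≤ (M.group i k).card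
    · right
      have ih := (card_group i k).resolve_left (by omega)
      obtain ⟨j, hj, hji⟩ := M.splits _ h (!M.team (M.group i k) i)
      have : (M.group i (k + 1)).card < (M.group i k).card := by
        simp only [group, subgroup, if_pos h]
        apply Finset.card_lt_card
        refine Finset.filter_ssubset.2 ⟨j, hj, ?_⟩
        simp [hji]
      omega
    · left
      simpa [group, subgroup, if_neg h] using h

theorem card_group_self (i : Fin n) : (M.group i n).card < 2 := by
  rcases M.card_group i n with h | h <;> omega

theorem eq_of_mem_group {i j : Fin n} {k : ℕ} (h : ¬ 2 ≤ (M.group i k).card)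
    (hj : j ∈ M.group i k) : j = i :=
  Finset.card_le_one.1 (by omega) _ hj _ (M.mem_group i k)

end TeamScheme

end DetObjectType

/-! ### Local states of the tournament and a step bound. -/

/-- The program counter of a process that takes part in the contest of its group. -/
inductive ContestPc
  | announce
  | look
  | check
  | act
  | relook
  | fetch (b : Bool)

/-- The local states of the tournament algorithm: a process has returned `v`, or it takes part in
the contest of level `k` with the value `v`. -/
inductive ContestState (V : Type v) : Type (max u v)
  | done (v : V)
  | run (k : ℕ) (pc : ContestPc) (v : V)

namespace ContestState

/-- The local state of a process that has obtained the value `v` of its group of level `k`. -/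
def finish {V : Type v} : ℕ → V → ContestState.{u, v} V
  | 0, v => done v
  | k + 1, v => run k .announce v

def value {V : Type v} : ContestState.{u, v} V → V
  | done v => v
  | run _ _ v => v

@[simp]
theorem value_finish {V : Type v} (k : ℕ) (v : V) : (finish.{u, v} k v).value = v := by
  cases k <;> rfl

/-- A bound for the number of steps until the process returns. -/
def remaining {V : Type v} : ContestState.{u, v} V → ℕ
  | done _ => 0
  | run k .announce _ => 6 * k + 6
  | run k .look _ => 6 * k + 5
  | run k .check _ => 6 * k + 4
  | run k .act _ => 6 * k + 3
  | run k .relook _ => 6 * k + 2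
  | run k (.fetch _) _ => 6 * k + 1

theorem remaining_finish {V : Type v} (k : ℕ) (v : V) : (finish.{u, v} k v).remaining = 6 * k := by
  cases k <;> simp [finish, remaining] ; omega

/-- The process has found the object of level `k` in its initial state and has neither applied
its operation nor given up doing so. -/
def Engaged {V : Type v} (k : ℕ) (ℓ : ContestState.{u, v} V) : Prop :=
  ∃ v, ℓ = run k .check v ∨ ℓ = run k .act v

/-- The process is about to apply its operation to the object of level `k`. -/
def Acting {V : Type v} (k : ℕ) (ℓ : ContestState.{u, v} V) : Prop :=
  ∃ v, ℓ = run k .act v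

theorem Acting.engaged {V : Type v} {k : ℕ} {ℓ : ContestState.{u, v} V} (h : ℓ.Acting k) :
    ℓ.Engaged k :=
  h.imp fun _ => Or.inr

theorem not_engaged_finish {V : Type v} (k k' : ℕ) (v : V) :
    ¬ (finish.{u, v} k v).Engaged k' := by
  rintro ⟨w, h | h⟩ <;> cases k <;> simp [finish] at h

end ContestState

/-! ### The effect of a single step. -/

namespace Algorithm

variable {T : DetObjectType.{u}} {n : ℕ} {V : Type v} {P : Algorithm.{u, v} T n V}
  {c : P.Config} {i : Fin n} {ℓ : P.L}

theorem after_step_of_output {a : V} (x : Fin n → V) (h : P.next i (c.loc i) = .output a) :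
    P.after x c (.step i) = c := by
  simp only [after, h]

theorem after_step_of_read {r : P.Reg} {k : P.W → P.L} (x : Fin n → V)
    (h : P.next i (c.loc i) = .read r k) (hk : k (c.reg r) = ℓ) :
    P.after x c (.step i) = { c with loc := Function.update c.loc i ℓ } := by
  simp only [after, h, hk]

theorem after_step_of_write [DecidableEq P.Reg] {r : P.Reg} {w : P.W} (x : Fin n → V)
    (h : P.next i (c.loc i) = .write r w ℓ) :
    P.after x c (.step i) =
      { c with loc := Function.update c.loc i ℓ, reg := Function.update c.reg r w } := by
  simp only [after, h]
  congr!

theorem after_step_of_invoke [DecidableEq P.Obj] {o : P.Obj} {op : T.Op} {k : T.Resp → P.L}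
    (x : Fin n → V) (h : P.next i (c.loc i) = .invoke o op k)
    (hk : k (T.apply (c.obj o) op).2 = ℓ) :
    P.after x c (.step i) =
      { c with
        loc := Function.update c.loc i ℓ
        obj := Function.update c.obj o (T.apply (c.obj o) op).1 } := by
  simp only [after, h, hk]
  congr!

theorem after_step_of_invoke_unchanged {o : P.Obj} {op : T.Op} {k : T.Resp → P.L} {r : T.Resp}
    (x : Fin n → V) (h : P.next i (c.loc i) = .invoke o op k)
    (hr : T.apply (c.obj o) op = (c.obj o, r)) (hk : k r = ℓ) :
    P.after x c (.step i) = { c with loc := Function.update c.loc i ℓ } := by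
  simp only [after, h, hr, hk, Function.update_eq_self]

end Algorithm

/-! ### The tournament algorithm. -/

namespace DetObjectType.TeamScheme

open ContestState

variable {T : DetObjectType.{u}} {n : ℕ} (M : T.TeamScheme n)

open Classical in
/-- The tournament algorithm. In the contest of a group, every process announces the value of its
own team in a register and applies its operation to the object of the group if it finds that
object in its initial state; the state of the object then tells which team has been first. If the
object can return to its initial state after a start by the team `true`, then the single member of
the other team applies its operation only if the team `true` has not announced a value. -/
noncomputable def tournament (rd : T.Op) (enc : T.State → T.Resp) (V : Type v) :
    Algorithm.{u, v} T n V where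
  Obj := ℕ × Finset (Fin n)
  Reg := ℕ × Finset (Fin n) × Bool
  W := ULift.{u} (Option V)
  L := ContestState.{u, v} V
  objInit _ := M.init
  regInit _ := ⟨none⟩
  start _ v := finish n v
  next i
    | done v => .output v
    | run k .announce v =>
      .write (k, M.group i k, M.team (M.group i k) i) ⟨some v⟩
        (if 2 ≤ (M.group i k).card then run k .look v else finish k v)
    | run k .look v =>
      .invoke (k, M.group i k) rd fun r =>
        if r = enc M.init then
          if M.team (M.group i k) i = false ∧ M.init ∈ M.Q true then run k .check v
          else run k .act v
        else run k .relook v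
    | run k .check v =>
      .read (k, M.group i k, true) fun w =>
        if w.down = none then run k .act v else run k (.fetch true) v
    | run k .act v =>
      .invoke (k, M.group i k) (M.op (M.group i k) i) fun _ => run k .relook v
    | run k .relook v =>
      .invoke (k, M.group i k) rd fun r => run k (.fetch (decide (r ∈ enc '' M.Q true))) v
    | run k (.fetch b) v =>
      -- The default `v` is never used in an execution: by `Inv.announced` a winning team has
      -- announced a value.
      .read (k, M.group i k, b) fun w => finish k (w.down.getD v)

instance {V : Type v} {rd : T.Op} {enc : T.State → T.Resp} :
    DecidableEq (M.tournament rd enc V).Obj :=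
  inferInstanceAs (DecidableEq (ℕ × Finset (Fin n)))

instance {V : Type v} {rd : T.Op} {enc : T.State → T.Resp} :
    DecidableEq (M.tournament rd enc V).Reg :=
  inferInstanceAs (DecidableEq (ℕ × Finset (Fin n) × Bool))

/-! ### The invariant and its preservation. -/

section Invariant

/-- Auxiliary history of the object of a group: the processes that have applied their operations
since the object was last in its initial state, and whether the team `true` has won for good. -/
structure History (n : ℕ) where
  log : List (Fin n)
  locked : Prop

variable {V : Type v}

/-- The team `b` has won the contest of the node. -/
def Won (g : ℕ × Finset (Fin n) → History n) (k : ℕ) (S : Finset (Fin n)) (b : Bool) : Prop :=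
  (b = true ∧ (g (k, S)).locked) ∨ ∃ i l, (g (k, S)).log = i :: l ∧ M.team S i = b

/-- The value `v` is the outcome of the contest of the group `S` at level `k`. -/
def Decided (x : Fin n → V) (reg : ℕ × Finset (Fin n) × Bool → ULift.{u} (Option V))
    (g : ℕ × Finset (Fin n) → History n) (k : ℕ) (S : Finset (Fin n)) (v : V) : Prop :=
  (2 ≤ S.card → ∃ b, M.Won g k S b ∧ reg (k, S, b) = ⟨some v⟩) ∧
    (¬ 2 ≤ S.card → ∀ i ∈ S, x i = v)

/-- What holds for the local state of process `i`. -/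
def LocalInv (x : Fin n → V) (reg : ℕ × Finset (Fin n) × Bool → ULift.{u} (Option V))
    (g : ℕ × Finset (Fin n) → History n) (i : Fin n) : ContestState.{u, v} V → Prop
  | done v => M.Decided x reg g 0 Finset.univ v
  | run k .announce v => M.Decided x reg g (k + 1) (M.group i (k + 1)) v
  | run k .look _ => 2 ≤ (M.group i k).card ∧
      ∃ w, reg (k, M.group i k, M.team (M.group i k) i) = ⟨some w⟩
  | run k .check _ => 2 ≤ (M.group i k).card ∧
      (∃ w, reg (k, M.group i k, M.team (M.group i k) i) = ⟨some w⟩) ∧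
      M.team (M.group i k) i = false ∧ M.init ∈ M.Q true
  | run k .act _ => 2 ≤ (M.group i k).card ∧
      ∃ w, reg (k, M.group i k, M.team (M.group i k) i) = ⟨some w⟩
  | run k .relook _ => 2 ≤ (M.group i k).card ∧ ∃ b, M.Won g k (M.group i k) b
  | run k (.fetch b) _ => 2 ≤ (M.group i k).card ∧ M.Won g k (M.group i k) b

/-- What holds for the object and the registers of the group `S` at level `k`. -/
structure NodeInv (loc : Fin n → ContestState.{u, v} V) (q : T.State)
    (reg : ℕ × Finset (Fin n) × Bool → ULift.{u} (Option V))
    (h : History n) (k : ℕ) (S : Finset (Fin n)) : Prop where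
  nodup : h.log.Nodup
  state : q = T.stateAfter M.init (h.log.map (M.op S))
  ne_init : h.log ≠ [] → q ≠ M.init
  announced : ∀ i ∈ h.log, ∃ w, reg (k, S, M.team S i) = ⟨some w⟩
  not_engaged : ∀ i ∈ h.log, M.group i k = S → ¬ (loc i).Engaged k
  init_mem : h.locked → M.init ∈ M.Q true
  announced_true : h.locked → ∃ w, reg (k, S, true) = ⟨some w⟩
  team_log : h.locked → ∀ i ∈ h.log, M.team S i = true
  not_acting : h.locked → ∀ i, M.team S i = false → M.group i k = S → ¬ (loc i).Acting k

/-- The invariant of the tournament algorithm. -/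
structure Inv (x : Fin n → V) (loc : Fin n → ContestState.{u, v} V)
    (obj : ℕ × Finset (Fin n) → T.State)
    (reg : ℕ × Finset (Fin n) × Bool → ULift.{u} (Option V))
    (g : ℕ × Finset (Fin n) → History n) : Prop where
  node : ∀ k S, M.NodeInv loc (obj (k, S)) reg (g (k, S)) k S
  loc : ∀ i, M.LocalInv x reg g i (loc i)
  reg : ∀ k S b v, reg (k, S, b) = ⟨some v⟩ → M.Decided x reg g (k + 1) (M.subgroup S b) v

variable {M} {x : Fin n → V} {loc : Fin n → ContestState.{u, v} V}
  {obj : ℕ × Finset (Fin n) → T.State}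
  {reg reg' : ℕ × Finset (Fin n) × Bool → ULift.{u} (Option V)}
  {g g' : ℕ × Finset (Fin n) → History n}

/-- Outcomes are final because announced values do not change and wins are not lost; every event has
both properties. -/
theorem Decided.mono (hr : ∀ r v, reg r = ⟨some v⟩ → reg' r = ⟨some v⟩)
    (hg : ∀ k S b, M.Won g k S b → M.Won g' k S b) {k : ℕ} {S : Finset (Fin n)} {v : V}
    (h : M.Decided x reg g k S v) : M.Decided x reg' g' k S v :=
  ⟨fun hS => (h.1 hS).imp fun _ hb => ⟨hg _ _ _ hb.1, hr _ _ hb.2⟩, h.2⟩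

theorem LocalInv.mono (hr : ∀ r v, reg r = ⟨some v⟩ → reg' r = ⟨some v⟩)
    (hg : ∀ k S b, M.Won g k S b → M.Won g' k S b) {i : Fin n} {ℓ : ContestState.{u, v} V}
    (h : M.LocalInv x reg g i ℓ) : M.LocalInv x reg' g' i ℓ := by
  rcases ℓ with v | ⟨k, _ | _ | _ | _ | _ | b, v⟩
  · exact Decided.mono hr hg h
  · exact Decided.mono hr hg h
  · exact ⟨h.1, h.2.imp fun _ => hr _ _⟩
  · exact ⟨h.1, h.2.1.imp fun _ => hr _ _, h.2.2⟩
  · exact ⟨h.1, h.2.imp fun _ => hr _ _⟩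
  · exact ⟨h.1, h.2.imp fun _ => hg _ _ _⟩
  · exact ⟨h.1, hg _ _ _ h.2⟩

theorem localInv_finish {i : Fin n} {k : ℕ} {v : V} (h : M.Decided x reg g k (M.group i k) v) :
    M.LocalInv x reg g i (finish k v) := by
  cases k <;> exact h

/-- The outcome of a contest is unique. -/
theorem Inv.decided_unique (h : M.Inv x loc obj reg g) {k : ℕ} {S : Finset (Fin n)} {v w : V}
    (hS : S.Nonempty) (hv : M.Decided x reg g k S v) (hw : M.Decided x reg g k S w) : v = w := by
  by_cases hc : 2 ≤ S.card
  · obtain ⟨b, hb, hbv⟩ := hv.1 hc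
    obtain ⟨c, hc', hcw⟩ := hw.1 hc
    have hbc : b = c := by
      -- A lock and a nonempty log name the same winner, since a locked log has members of the team
      -- `true` only.
      rcases hb with ⟨rfl, hl⟩ | ⟨i, l, hl, rfl⟩ <;> rcases hc' with ⟨rfl, hl'⟩ | ⟨j, l', hl', rfl⟩
      · rfl
      · exact ((h.node k S).team_log hl j (by simp [hl'])).symm
      · exact (h.node k S).team_log hl' i (by simp [hl])
      · rw [hl] at hl'
        rw [(List.cons.inj hl').1]
    subst hbc
    rw [hbv] at hcw
    simpa using hcw
  · obtain ⟨i, hi⟩ := hS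
    exact (hv.2 hc i hi).symm.trans (hw.2 hc i hi)

theorem Inv.announced (h : M.Inv x loc obj reg g) {k : ℕ} {S : Finset (Fin n)} {b : Bool}
    (hb : M.Won g k S b) : ∃ w, reg (k, S, b) = ⟨some w⟩ := by
  rcases hb with ⟨rfl, hl⟩ | ⟨i, l, hl, rfl⟩
  · exact (h.node k S).announced_true hl
  · exact (h.node k S).announced i (by simp [hl])

/-- The state of the object tells which team has won. -/
theorem Inv.won_of_state (h : M.Inv x loc obj reg g) {k : ℕ} {S : Finset (Fin n)}
    (hb : ∃ b, M.Won g k S b) {b : Bool} (hbq : b = true ↔ obj (k, S) ∈ M.Q true) :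
    M.Won g k S b := by
  have hn := h.node k S
  have hst := hn.state
  rcases hl : (g (k, S)).log with _ | ⟨i, l⟩
  -- With an empty log the win comes from the lock, and the initial state, which is then in `Q
  -- true`, is read correctly.
  · obtain ⟨c, ⟨rfl, hc⟩ | ⟨i, l, hl', -⟩⟩ := hb
    · have : b = true := by
        rw [hbq, hst, hl]
        exact hn.init_mem hc
      exact Or.inl ⟨this, hc⟩
    · simp [hl] at hl'
  · refine Or.inr ⟨i, l, hl, ?_⟩
    have hQ := M.mem_Q S i l (hl ▸ hn.nodup)
    rw [← hl, ← hst] at hQ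
    cases ht : M.team S i
    · rw [ht] at hQ
      cases b
      · rfl
      · exact absurd hQ (M.not_mem_both _ (hbq.1 rfl))
    · rw [ht] at hQ
      exact (hbq.2 hQ).symm

/-- A change of the local state of a process that does not get engaged keeps the invariant of a
node. -/
theorem NodeInv.update {q : T.State} {h : History n} {k : ℕ} {S : Finset (Fin n)}
    (hn : M.NodeInv loc q reg h k S) (hr : ∀ r v, reg r = ⟨some v⟩ → reg' r = ⟨some v⟩)
    (i : Fin n) (ℓ : ContestState.{u, v} V)
    (he : M.group i k = S → ℓ.Engaged k → i ∉ h.log)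
    (ha : M.group i k = S → ℓ.Acting k → h.locked → M.team S i = true) :
    M.NodeInv (Function.update loc i ℓ) q reg' h k S where
  nodup := hn.nodup
  state := hn.state
  ne_init := hn.ne_init
  announced j hj := (hn.announced j hj).imp fun _ => hr _ _
  not_engaged j hj hS := by
    by_cases hji : j = i
    · subst hji
      rw [Function.update_self]
      exact fun h' => he hS h' hj
    · rw [Function.update_of_ne hji]
      exact hn.not_engaged j hj hS
  init_mem := hn.init_mem
  announced_true hl := (hn.announced_true hl).imp fun _ => hr _ _
  team_log := hn.team_log
  not_acting hl j hj hS := by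
    by_cases hji : j = i
    · subst hji
      rw [Function.update_self]
      intro h'
      simp [ha hS h' hl] at hj
    · rw [Function.update_of_ne hji]
      exact hn.not_acting hl j hj hS

/-- A change of the local state of a process keeps the invariant. -/
theorem Inv.update (h : M.Inv x loc obj reg g) (i : Fin n) (ℓ : ContestState.{u, v} V)
    (hℓ : M.LocalInv x reg g i ℓ)
    (he : ∀ k, ℓ.Engaged k → i ∉ (g (k, M.group i k)).log)
    (ha : ∀ k, ℓ.Acting k → (g (k, M.group i k)).locked → M.team (M.group i k) i = true) :
    M.Inv x (Function.update loc i ℓ) obj reg g where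
  node k S := (h.node k S).update (fun _ _ => id) i ℓ (by rintro rfl; exact he k)
    (by rintro rfl; exact ha k)
  loc j := by
    by_cases hji : j = i
    · subst hji
      rwa [Function.update_self]
    · rw [Function.update_of_ne hji]
      exact h.loc j
  reg := h.reg

theorem Inv.update_of_not_engaged (h : M.Inv x loc obj reg g) (i : Fin n)
    (ℓ : ContestState.{u, v} V) (hℓ : M.LocalInv x reg g i ℓ) (he : ∀ k, ¬ ℓ.Engaged k) :
    M.Inv x (Function.update loc i ℓ) obj reg g :=
  h.update i ℓ hℓ (fun k hk => absurd hk (he k)) fun k hk => absurd hk.engaged (he k)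

theorem not_engaged_run {k k' : ℕ} {pc : ContestPc} {v : V} (h1 : pc ≠ .check) (h2 : pc ≠ .act) :
    ¬ (run.{u, v} k pc v).Engaged k' := by
  rintro ⟨w, h | h⟩ <;> simp_all

/-- A process recovers. -/
theorem Inv.crash (h : M.Inv x loc obj reg g) (i : Fin n) :
    M.Inv x (Function.update loc i (finish n (x i))) obj reg g :=
  h.update_of_not_engaged i _
    (localInv_finish ⟨fun hc => absurd hc (by have := M.card_group_self i; omega),
      fun hc j hj => by rw [M.eq_of_mem_group hc hj]⟩)
    fun k => not_engaged_finish n k _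

/-- A process announces the value of its team. -/
theorem Inv.announce [DecidableEq (ℕ × Finset (Fin n) × Bool)] (h : M.Inv x loc obj reg g) {i : Fin n} {k : ℕ} {v : V}
    (hi : loc i = run k .announce v) :
    (∀ r w, reg r = ⟨some w⟩ →
      Function.update reg (k, M.group i k, M.team (M.group i k) i) ⟨some v⟩ r = ⟨some w⟩) ∧
    M.Inv x (Function.update loc i
        (if 2 ≤ (M.group i k).card then run k .look v else finish k v)) obj
      (Function.update reg (k, M.group i k, M.team (M.group i k) i) ⟨some v⟩) g := by
  have hd : M.Decided x reg g (k + 1) (M.group i (k + 1)) v := by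
    have := h.loc i
    rwa [hi] at this
  have hr : ∀ r w, reg r = ⟨some w⟩ →
      Function.update reg (k, M.group i k, M.team (M.group i k) i) ⟨some v⟩ r = ⟨some w⟩ := by
    intro r w hw
    by_cases hrr : r = (k, M.group i k, M.team (M.group i k) i)
    · subst hrr
      -- The old value and the new one are both outcomes of the same subgroup, so overwriting
      -- changes nothing.
      rw [Function.update_self,
        h.decided_unique ⟨i, M.mem_group i (k + 1)⟩ hd (h.reg _ _ _ _ hw)]
    · rwa [Function.update_of_ne hrr]
  have hg : ∀ k S b, M.Won g k S b → M.Won g k S b := fun _ _ _ => id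
  refine ⟨hr, ?_, ?_, ?_⟩
  · intro k' S
    refine (h.node k' S).update hr i _ ?_ ?_ <;> intro _ h1 <;> exfalso
    · split_ifs at h1
      · exact not_engaged_run (by simp) (by simp) h1
      · exact not_engaged_finish _ _ _ h1
    · split_ifs at h1
      · exact not_engaged_run (by simp) (by simp) h1.engaged
      · exact not_engaged_finish _ _ _ h1.engaged
  · intro j
    by_cases hji : j = i
    · subst hji
      rw [Function.update_self]
      split_ifs with hc
      · exact ⟨hc, v, Function.update_self ..⟩
      · refine localInv_finish ⟨fun hc' => absurd hc' hc, fun _ m hm => ?_⟩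
        have hs : M.group j (k + 1) = M.group j k := by simp [group, subgroup, if_neg hc]
        rw [hs] at hd
        exact hd.2 hc m hm
    · rw [Function.update_of_ne hji]
      exact (h.loc j).mono hr hg
  · intro k' S b w hw
    refine Decided.mono hr hg ?_
    by_cases hrr : (k', S, b) = (k, M.group i k, M.team (M.group i k) i)
    · rw [hrr, Function.update_self] at hw
      simp only [Prod.mk.injEq] at hrr
      obtain ⟨rfl, rfl, rfl⟩ := hrr
      simp only [ULift.up.injEq, Option.some.injEq] at hw
      exact hw ▸ hd
    · rw [Function.update_of_ne hrr] at hw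
      exact h.reg _ _ _ _ hw

/-- The member of a one-element team sees that the other team has announced a value. -/
theorem Inv.give_up (h : M.Inv x loc obj reg g) {i : Fin n} {k : ℕ} {v w : V}
    (hi : loc i = run k .check v) (hw : reg (k, M.group i k, true) = ⟨some w⟩) :
    ∃ g', (∀ k S b, M.Won g k S b → M.Won g' k S b) ∧
      M.Inv x (Function.update loc i (run k (.fetch true) v)) obj reg g' := by
  have hl := h.loc i
  rw [hi] at hl
  obtain ⟨hc, -, ht, hQ⟩ := hl
  have hn := h.node k (M.group i k)
  have hlog : i ∉ (g (k, M.group i k)).log := fun hmem =>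
    hn.not_engaged i hmem rfl ⟨v, Or.inl hi⟩
  set g' := Function.update g (k, M.group i k) ⟨(g (k, M.group i k)).log, True⟩ with hg'
  have hg : ∀ k S b, M.Won g k S b → M.Won g' k S b := by
    intro k' S b hb
    by_cases hν : (k', S) = (k, M.group i k)
    · simp only [Prod.mk.injEq] at hν
      obtain ⟨rfl, rfl⟩ := hν
      rcases hb with ⟨hb, -⟩ | hb
      · exact Or.inl ⟨hb, by simp [hg']⟩
      · exact Or.inr (by simpa [hg'] using hb)
    · simpa [Won, hg', Function.update_of_ne hν] using hb
  refine ⟨g', hg, ?_, ?_, ?_⟩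
  · intro k' S
    have hu := (h.node k' S).update (fun _ _ => id) i (run k (.fetch true) v)
      (fun _ he => absurd he (not_engaged_run (by simp) (by simp)))
      (fun _ ha => absurd ha.engaged (not_engaged_run (by simp) (by simp)))
    by_cases hν : (k', S) = (k, M.group i k)
    · simp only [Prod.mk.injEq] at hν
      obtain ⟨rfl, rfl⟩ := hν
      rw [hg', Function.update_self]
      refine ⟨hu.nodup, hu.state, hu.ne_init, hu.announced, hu.not_engaged, fun _ => hQ,
        fun _ => ⟨w, hw⟩, fun _ j hj => ?_, fun _ j hj _ => ?_⟩
      · by_contra hjt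
        rw [Bool.not_eq_true] at hjt
        -- The yielding process is the only member of its team and has not moved, so the log
        -- contains only its opponents and the lock is justified.
        exact hlog (M.solo hQ _ _ _ hjt ht ▸ hj)
      · rw [M.solo hQ _ _ _ hj ht, Function.update_self]
        exact fun ha => absurd ha.engaged (not_engaged_run (by simp) (by simp))
    · rw [hg', Function.update_of_ne hν]
      exact hu
  · intro j
    by_cases hji : j = i
    · subst hji
      rw [Function.update_self]
      exact ⟨hc, Or.inl ⟨rfl, by simp [hg']⟩⟩
    · rw [Function.update_of_ne hji]
      exact (h.loc j).mono (fun _ _ => id) hg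
  · exact fun k S b v hv => (h.reg k S b v hv).mono (fun _ _ => id) hg

/-- A process applies its operation. -/
theorem Inv.act [DecidableEq (ℕ × Finset (Fin n))] (h : M.Inv x loc obj reg g) {i : Fin n} {k : ℕ} {v : V}
    (hi : loc i = run k .act v) :
    ∃ g', (∀ k S b, M.Won g k S b → M.Won g' k S b) ∧
      M.Inv x (Function.update loc i (run k .relook v))
        (Function.update obj (k, M.group i k)
          (T.apply (obj (k, M.group i k)) (M.op (M.group i k) i)).1) reg g' := by
  have hl := h.loc i
  rw [hi] at hl
  obtain ⟨hc, hann⟩ := hl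
  obtain ⟨S, hS⟩ : ∃ S, M.group i k = S := ⟨_, rfl⟩
  rw [hS] at hc hann ⊢
  have hn := h.node k S
  set q' := (T.apply (obj (k, S)) (M.op S i)).1 with hq'
  set l := (g (k, S)).log with hl
  have hlog : i ∉ l := fun hmem => hn.not_engaged i hmem hS ⟨v, Or.inr hi⟩
  have hnodup : (l ++ [i]).Nodup :=
    List.Nodup.append hn.nodup (List.nodup_singleton i) (by simpa using hlog)
  have hstate : q' = T.stateAfter M.init ((l ++ [i]).map (M.op S)) := by
    rw [List.map_append, stateAfter_append, ← hn.state]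
    rfl
  obtain ⟨f, t, hft⟩ : ∃ f t, l ++ [i] = f :: t := List.exists_cons_of_ne_nil (by simp)
  have hann' : ∀ j ∈ l ++ [i], ∃ w, reg (k, S, M.team S j) = ⟨some w⟩ := by
    intro j hj
    rcases List.mem_append.1 hj with hj | hj
    · exact hn.announced j hj
    · rw [List.mem_singleton.1 hj]
      exact hann
  have hfirst : ∀ j l', l = j :: l' → j = f := by
    intro j l' hjl
    rw [hjl, List.cons_append] at hft
    exact (List.cons.inj hft).1
  have hne : ∀ k', ¬ (run.{u, v} k .relook v).Engaged k' := fun k' =>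
    not_engaged_run (by simp) (by simp)
  have heng : ∀ j ∈ l ++ [i], M.group j k = S →
      ¬ (Function.update loc i (run k .relook v) j).Engaged k := by
    intro j hj hjS
    by_cases hji : j = i
    · rw [hji, Function.update_self]
      exact hne k
    · rw [Function.update_of_ne hji]
      refine hn.not_engaged j ?_ hjS
      simpa [hji] using hj
  obtain ⟨h', hh', hinv⟩ : ∃ h' : History n,
      ((∃ b, M.Won (Function.update g (k, S) h') k S b) ∧
        ∀ b, M.Won g k S b → M.Won (Function.update g (k, S) h') k S b) ∧
      M.NodeInv (Function.update loc i (run k .relook v)) q' reg h' k S := by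
    by_cases hq0 : q' = M.init
    -- The object has returned to its initial state: the log is emptied and the lock preserves the
    -- win of the team `true`.
    · rw [hstate, hft] at hq0
      rw [hft] at hnodup
      obtain ⟨hft', hall⟩ := M.of_stateAfter_eq_init hnodup hq0
      have hQ := M.mem_Q S f t hnodup
      rw [hft', hq0] at hQ
      refine ⟨⟨[], True⟩, ⟨⟨true, Or.inl ⟨rfl, by simp⟩⟩, ?_⟩, ?_⟩
      · rintro b (⟨rfl, -⟩ | ⟨j, l', hjl, rfl⟩)
        · exact Or.inl ⟨rfl, by simp⟩
        · exact Or.inl ⟨by rw [hfirst j l' hjl, hft'], by simp⟩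
      · refine ⟨List.nodup_nil, by rw [hstate, hft, hq0]; rfl, by simp, by simp, by simp,
          fun _ => hQ, fun _ => ?_, by simp, fun _ j hj hjS ha => ?_⟩
        · obtain ⟨w, hw⟩ := hann' f (by simp [hft])
          exact ⟨w, hft' ▸ hw⟩
        -- Every member of the team `false` has moved in the closed sequence, so none has a move
        -- pending from before the return.
        · exact heng j (hft ▸ hall j hj) hjS ha.engaged
    · refine ⟨⟨l ++ [i], (g (k, S)).locked⟩, ⟨⟨_, Or.inr ⟨f, t, by simpa using hft, rfl⟩⟩, ?_⟩, ?_⟩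
      · rintro b (⟨rfl, hb⟩ | ⟨j, l', hjl, rfl⟩)
        · exact Or.inl ⟨rfl, by simpa using hb⟩
        · exact Or.inr ⟨f, t, by simpa using hft, by rw [hfirst j l' hjl]⟩
      · refine ⟨hnodup, hstate, fun _ => hq0, hann', heng, hn.init_mem, hn.announced_true,
          fun hlk j hj => ?_, fun hlk j hj hjS => ?_⟩
        · rcases List.mem_append.1 hj with hj | hj
          · exact hn.team_log hlk j hj
          · rw [List.mem_singleton.1 hj]
            by_contra hit
            exact hn.not_acting hlk i (by simpa using hit) hS ⟨v, hi⟩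
        · by_cases hji : j = i
          · rw [hji, Function.update_self]
            exact fun ha => hne k ha.engaged
          · rw [Function.update_of_ne hji]
            exact hn.not_acting hlk j hj hjS
  have hg : ∀ k' S' b, M.Won g k' S' b → M.Won (Function.update g (k, S) h') k' S' b := by
    intro k' S' b hb
    by_cases hν : (k', S') = (k, S)
    · simp only [Prod.mk.injEq] at hν
      obtain ⟨rfl, rfl⟩ := hν
      exact hh'.2 b hb
    · simpa [Won, Function.update_of_ne hν] using hb
  refine ⟨Function.update g (k, S) h', hg, ?_, ?_, ?_⟩
  · intro k' S'
    by_cases hν : (k', S') = (k, S)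
    · rw [hν, Function.update_self, Function.update_self]
      simp only [Prod.mk.injEq] at hν
      obtain ⟨rfl, rfl⟩ := hν
      exact hinv
    · rw [Function.update_of_ne hν, Function.update_of_ne hν]
      exact (h.node k' S').update (fun _ _ => id) i _ (fun _ he => absurd he (hne k'))
        (fun _ ha => absurd ha.engaged (hne k'))
  · intro j
    by_cases hji : j = i
    · subst hji
      rw [Function.update_self]
      show 2 ≤ (M.group j k).card ∧ ∃ b, M.Won _ k (M.group j k) b
      rw [hS]
      exact ⟨hc, hh'.1⟩
    · rw [Function.update_of_ne hji]
      exact (h.loc j).mono (fun _ _ => id) hg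
  · exact fun k S b v hv => (h.reg k S b v hv).mono (fun _ _ => id) hg

end Invariant

/-! ### Agreement, validity and recoverable wait-freedom. -/

section Correctness

variable {V : Type v} {rd : T.Op} {enc : T.State → T.Resp}

theorem inv_initial (x : Fin n → V) :
    M.Inv x ((M.tournament rd enc V).initial x).loc ((M.tournament rd enc V).initial x).obj
      ((M.tournament rd enc V).initial x).reg fun _ => ⟨[], False⟩ where
  node k S := ⟨List.nodup_nil, rfl, by simp, by simp, by simp, by simp, by simp, by simp, by simp⟩
  loc i := localInv_finish ⟨fun hc => absurd hc (by have := M.card_group_self i; omega),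
    fun hc j hj => by rw [M.eq_of_mem_group hc hj]⟩
  reg k S b v hv := by simp [Algorithm.initial, tournament] at hv

/-- Every event keeps the invariant, and no contest that is won gets lost. -/
theorem Inv.after (henc : Function.Injective enc) (hrd : ∀ q, T.apply q rd = (q, enc q))
    {M : T.TeamScheme n} {x : Fin n → V} {c : (M.tournament rd enc V).Config}
    {g : ℕ × Finset (Fin n) → History n} (h : M.Inv x c.loc c.obj c.reg g) (e : Event n) :
    ∃ g', (∀ k S b, M.Won g k S b → M.Won g' k S b) ∧
      (∀ r v, c.reg r = ⟨some v⟩ → ((M.tournament rd enc V).after x c e).reg r = ⟨some v⟩) ∧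
      M.Inv x ((M.tournament rd enc V).after x c e).loc ((M.tournament rd enc V).after x c e).obj
        ((M.tournament rd enc V).after x c e).reg g' := by
  rcases e with i | i
  swap
  · exact ⟨g, fun _ _ _ => id, fun _ _ => id, h.crash i⟩
  have hl := h.loc i
  rcases hloc : c.loc i with v | ⟨k, _ | _ | _ | _ | _ | b, v⟩ <;> rw [hloc] at hl
  · rw [Algorithm.after_step_of_output x (a := v) (by rw [hloc]; rfl)]
    exact ⟨g, fun _ _ _ => id, fun _ _ => id, h⟩
  · rw [Algorithm.after_step_of_write (r := (k, M.group i k, M.team (M.group i k) i))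
      (w := (⟨some v⟩ : ULift.{u} (Option V)))
      (ℓ := if 2 ≤ (M.group i k).card then run k .look v else finish k v) x
      (by rw [hloc]; rfl)]
    exact ⟨g, fun _ _ _ => id, h.announce hloc⟩
  · have hn := h.node k (M.group i k)
    by_cases hq : c.obj (k, M.group i k) = M.init
    · have hlog : (g (k, M.group i k)).log = [] := by
        by_contra hne
        exact hn.ne_init hne hq
      by_cases ht : M.team (M.group i k) i = false ∧ M.init ∈ M.Q true
      · rw [Algorithm.after_step_of_invoke_unchanged (ℓ := run k .check v) x
          (by rw [hloc]; rfl) (hrd _) (by rw [if_pos (by rw [hq]), if_pos ht])]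
        refine ⟨g, fun _ _ _ => id, fun _ _ => id, h.update i _ ⟨hl.1, hl.2, ht⟩ ?_ ?_⟩
        · rintro k' ⟨w, he | he⟩ <;> cases he
          simp [hlog]
        · rintro k' ⟨w, he⟩
          cases he
      · rw [Algorithm.after_step_of_invoke_unchanged (ℓ := run k .act v) x
          (by rw [hloc]; rfl) (hrd _) (by rw [if_pos (by rw [hq]), if_neg ht])]
        refine ⟨g, fun _ _ _ => id, fun _ _ => id, h.update i _ hl ?_ ?_⟩
        · rintro k' ⟨w, he | he⟩ <;> cases he
          simp [hlog]
        · rintro k' ⟨w, he⟩ hlk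
          cases he
          by_contra hit
          -- A lock puts the initial state into `Q true`, so a member of the team `false` would have
          -- been sent to `check`.
          exact ht ⟨by simpa using hit, hn.init_mem hlk⟩
    · rw [Algorithm.after_step_of_invoke_unchanged (ℓ := run k .relook v) x
        (by rw [hloc]; rfl) (hrd _) (by rw [if_neg (fun he => hq (henc he))])]
      refine ⟨g, fun _ _ _ => id, fun _ _ => id, h.update_of_not_engaged i (run k .relook v)
        ⟨hl.1, ?_⟩ fun _ => not_engaged_run (by simp) (by simp)⟩
      rcases hlog : (g (k, M.group i k)).log with _ | ⟨j, l⟩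
      · have hst := hn.state
        rw [hlog] at hst
        exact absurd hst hq
      · exact ⟨_, Or.inr ⟨j, l, hlog, rfl⟩⟩
  · have hn := h.node k (M.group i k)
    rcases hw : c.reg (k, M.group i k, true) with ⟨_ | w⟩
    · rw [Algorithm.after_step_of_read (ℓ := run k .act v) x (by rw [hloc]; rfl) (by rw [hw]; rfl)]
      refine ⟨g, fun _ _ _ => id, fun _ _ => id, h.update i _ ⟨hl.1, hl.2.1⟩ ?_ ?_⟩
      · rintro k' ⟨w, he | he⟩ <;> cases he
        exact fun hmem => hn.not_engaged i hmem rfl ⟨v, Or.inl hloc⟩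
      · rintro k' ⟨w, he⟩ hlk
        cases he
        -- The register of the team `true` was found empty, so the node cannot be locked.
        obtain ⟨u, hu⟩ := hn.announced_true hlk
        rw [hu] at hw
        cases hw
    · rw [Algorithm.after_step_of_read (ℓ := run k (.fetch true) v) x (by rw [hloc]; rfl)
        (by rw [hw]; rfl)]
      obtain ⟨g', hg, hinv⟩ := h.give_up hloc hw
      exact ⟨g', hg, fun _ _ => id, hinv⟩
  · obtain ⟨g', hg, hinv⟩ := h.act hloc
    rw [Algorithm.after_step_of_invoke (o := (k, M.group i k)) (ℓ := run k .relook v) x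
      (by rw [hloc]; rfl) rfl]
    exact ⟨g', hg, fun _ _ => id, hinv⟩
  · rw [Algorithm.after_step_of_invoke_unchanged x (by rw [hloc]; rfl) (hrd _) rfl]
    exact ⟨g, fun _ _ _ => id, fun _ _ => id, h.update_of_not_engaged i (run k (.fetch _) v)
      ⟨hl.1, h.won_of_state hl.2 (by simp [henc.mem_set_image])⟩
      fun _ => not_engaged_run (by simp) (by simp)⟩
  · obtain ⟨w, hw⟩ := h.announced hl.2
    rw [Algorithm.after_step_of_read (ℓ := finish k w) x (by rw [hloc]; rfl) (by rw [hw]; rfl)]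
    exact ⟨g, fun _ _ _ => id, fun _ _ => id, h.update_of_not_engaged i _
      (localInv_finish ⟨fun _ => ⟨b, hl.2, hw⟩, fun hc => absurd hl.1 hc⟩)
      fun _ => not_engaged_finish _ _ _⟩

theorem exists_inv_configAt (henc : Function.Injective enc) (hrd : ∀ q, T.apply q rd = (q, enc q))
    (x : Fin n → V) (σ : ℕ → Event n) : ∃ g : ℕ → ℕ × Finset (Fin n) → History n,
      ∀ t, M.Inv x ((M.tournament rd enc V).configAt x σ t).loc
          ((M.tournament rd enc V).configAt x σ t).obj
          ((M.tournament rd enc V).configAt x σ t).reg (g t) ∧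
        (∀ k S b, M.Won (g t) k S b → M.Won (g (t + 1)) k S b) ∧
        ∀ r v, ((M.tournament rd enc V).configAt x σ t).reg r = ⟨some v⟩ →
          ((M.tournament rd enc V).configAt x σ (t + 1)).reg r = ⟨some v⟩ := by
  have hstep := fun t (g : {g // M.Inv x ((M.tournament rd enc V).configAt x σ t).loc
      ((M.tournament rd enc V).configAt x σ t).obj
      ((M.tournament rd enc V).configAt x σ t).reg g}) => g.2.after henc hrd (σ t)
  choose f hf using hstep
  -- The next history depends on the invariant for the current one, so the recursion carries both.
  let G : ∀ t, {g // M.Inv x ((M.tournament rd enc V).configAt x σ t).loc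
      ((M.tournament rd enc V).configAt x σ t).obj
      ((M.tournament rd enc V).configAt x σ t).reg g} :=
    fun t => Nat.rec ⟨_, M.inv_initial x⟩ (fun t g => ⟨f t g, (hf t g).2.2⟩) t
  exact ⟨fun t => (G t).1, fun t => ⟨(G t).2, (hf t (G t)).1, (hf t (G t)).2.1⟩⟩

theorem eq_of_next_eq_output {i : Fin n} {ℓ : ContestState.{u, v} V} {a : V}
    (h : (M.tournament rd enc V).next i ℓ = .output a) : ℓ = done a := by
  rcases ℓ with v | ⟨k, _ | _ | _ | _ | _ | b, v⟩ <;> simp [tournament] at h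
  rw [h]

/-- Every output is the outcome of the root; the earlier of two outputs persists until the later
one, where uniqueness applies. -/
theorem tournament_agreement (henc : Function.Injective enc)
    (hrd : ∀ q, T.apply q rd = (q, enc q)) : (M.tournament rd enc V).Agreement := by
  intro x σ s t i j a b ha hb
  obtain ⟨g, hg⟩ := M.exists_inv_configAt henc hrd x σ
  have hdec : ∀ t i a, (M.tournament rd enc V).Outputs
      ((M.tournament rd enc V).configAt x σ t) i a →
      M.Decided x ((M.tournament rd enc V).configAt x σ t).reg (g t) 0 Finset.univ a := by
    intro t i a ha
    have := (hg t).1.loc i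
    rwa [M.eq_of_next_eq_output ha] at this
  have hmono : ∀ s t, s ≤ t → ∀ a,
      M.Decided x ((M.tournament rd enc V).configAt x σ s).reg (g s) 0 Finset.univ a →
      M.Decided x ((M.tournament rd enc V).configAt x σ t).reg (g t) 0 Finset.univ a := by
    intro s t hst a h
    induction t, hst using Nat.le_induction with
    | base => exact h
    | succ t _ ih => exact ih.mono (hg t).2.2 (hg t).2.1
  rcases le_total s t with hst | hst
  · exact (hg t).1.decided_unique ⟨i, Finset.mem_univ i⟩ (hmono s t hst a (hdec s i a ha))
      (hdec t j b hb)
  · exact (hg s).1.decided_unique ⟨i, Finset.mem_univ i⟩ (hdec s i a ha)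
      (hmono t s hst b (hdec t j b hb))

theorem after_step_loc_of_ne {P : Algorithm.{u, v} T n V} (x : Fin n → V) (c : P.Config)
    {i j : Fin n} (h : j ≠ i) : (P.after x c (.step i)).loc j = c.loc j := by
  unfold Algorithm.after
  dsimp only
  split <;> simp [Function.update_of_ne h]

/-- A step of a process that has not returned brings it closer to returning, and the values that
it keeps or announces come from its local state or from a register. -/
theorem after_step_spec (hrd : ∀ q, T.apply q rd = (q, enc q)) (x : Fin n → V) (c : (M.tournament rd enc V).Config) (i : Fin n) :
    ((∃ a, c.loc i = done a) ∨
      (((M.tournament rd enc V).after x c (.step i)).loc i).remaining < (c.loc i).remaining) ∧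
    ((((M.tournament rd enc V).after x c (.step i)).loc i).value = (c.loc i).value ∨
      ∃ r, c.reg r = ⟨some (((M.tournament rd enc V).after x c (.step i)).loc i).value⟩) ∧
    ∀ r v, ((M.tournament rd enc V).after x c (.step i)).reg r = ⟨some v⟩ →
      c.reg r = ⟨some v⟩ ∨ v = (c.loc i).value := by
  have of_eq : ∀ (ℓ : ContestState.{u, v} V),
      ((M.tournament rd enc V).after x c (.step i)).loc i = ℓ →
      (∀ r v, ((M.tournament rd enc V).after x c (.step i)).reg r = ⟨some v⟩ →
        c.reg r = ⟨some v⟩ ∨ v = (c.loc i).value) →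
      ℓ.remaining < (c.loc i).remaining →
      (ℓ.value = (c.loc i).value ∨ ∃ r, c.reg r = ⟨some ℓ.value⟩) →
      ((∃ a, c.loc i = done a) ∨
        (((M.tournament rd enc V).after x c (.step i)).loc i).remaining < (c.loc i).remaining) ∧
      ((((M.tournament rd enc V).after x c (.step i)).loc i).value = (c.loc i).value ∨
        ∃ r, c.reg r = ⟨some (((M.tournament rd enc V).after x c (.step i)).loc i).value⟩) ∧
      ∀ r v, ((M.tournament rd enc V).after x c (.step i)).reg r = ⟨some v⟩ →
        c.reg r = ⟨some v⟩ ∨ v = (c.loc i).value := by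
    intro ℓ hi hr h1 h2
    exact ⟨Or.inr (by rwa [hi]), by rwa [hi], hr⟩
  have of_read : ∀ (ℓ : ContestState.{u, v} V), (M.tournament rd enc V).after x c (.step i) =
        { c with loc := Function.update c.loc i ℓ } →
      ℓ.remaining < (c.loc i).remaining →
      (ℓ.value = (c.loc i).value ∨ ∃ r, c.reg r = ⟨some ℓ.value⟩) → _ := fun ℓ hℓ =>
    of_eq ℓ (by rw [hℓ]; exact Function.update_self ..) (by rw [hℓ]; exact fun _ _ => Or.inl)
  rcases hloc : c.loc i with v | ⟨k, _ | _ | _ | _ | _ | b, v⟩ <;> rw [hloc] at of_eq of_read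
  · rw [Algorithm.after_step_of_output x (a := v) (by rw [hloc]; rfl), hloc]
    exact ⟨Or.inl ⟨v, rfl⟩, Or.inl rfl, fun _ _ => Or.inl⟩
  · obtain ⟨ℓ, hℓ⟩ : ∃ ℓ : ContestState.{u, v} V,
        (if 2 ≤ (M.group i k).card then run k .look v else finish k v) = ℓ := ⟨_, rfl⟩
    have he := Algorithm.after_step_of_write (P := M.tournament rd enc V)
      (r := (k, M.group i k, M.team (M.group i k) i)) (w := (⟨some v⟩ : ULift.{u} (Option V)))
      (ℓ := ℓ) x (by rw [hloc, ← hℓ]; rfl)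
    have hr : ∀ r w, ((M.tournament rd enc V).after x c (.step i)).reg r = ⟨some w⟩ →
        c.reg r = ⟨some w⟩ ∨ w = v := by
      intro r w hw
      rw [he] at hw
      by_cases hr : r = (k, M.group i k, M.team (M.group i k) i)
      · subst hr
        have := (Function.update_self ..).symm.trans hw
        cases this
        exact Or.inr rfl
      · exact Or.inl ((Function.update_of_ne hr ..).symm.trans hw)
    refine of_eq ℓ (by rw [he]; exact Function.update_self ..) hr ?_ (Or.inl ?_) <;>
      rw [← hℓ] <;> split_ifs
    · simp [remaining]
    · rw [remaining_finish]
      simp [remaining]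
    · rfl
    · exact value_finish _ _
  · refine of_read _ (Algorithm.after_step_of_invoke_unchanged x (by rw [hloc]; rfl) (hrd _) rfl)
      ?_ (Or.inl ?_) <;> split_ifs <;> simp [remaining, value]
  · refine of_read _ (Algorithm.after_step_of_read x (by rw [hloc]; rfl) rfl)
      ?_ (Or.inl ?_) <;> split_ifs <;> simp [remaining, value]
  · have he := Algorithm.after_step_of_invoke (P := M.tournament rd enc V)
      (o := (k, M.group i k)) (ℓ := run k .relook v) x (by rw [hloc]; rfl) rfl
    exact of_eq (run k .relook v) (by rw [he]; exact Function.update_self ..)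
      (by rw [he]; exact fun _ _ => Or.inl) (by simp [remaining]) (Or.inl rfl)
  · exact of_read (run k (.fetch _) v)
      (Algorithm.after_step_of_invoke_unchanged x (by rw [hloc]; rfl) (hrd _) rfl)
      (by simp [remaining]) (Or.inl rfl)
  · have hlt : 6 * k < (run.{u, v} k (.fetch b) v).remaining := Nat.lt_succ_self _
    -- The configuration is arbitrary here, so the register may be empty; the process then keeps its
    -- own value.
    rcases hw : c.reg (k, M.group i k, b) with ⟨_ | w⟩
    · exact of_read (finish k v)
        (Algorithm.after_step_of_read x (by rw [hloc]; rfl) (by rw [hw]; rfl))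
        (by rwa [remaining_finish]) (Or.inl (value_finish _ _))
    · exact of_read (finish k w)
        (Algorithm.after_step_of_read x (by rw [hloc]; rfl) (by rw [hw]; rfl))
        (by rwa [remaining_finish]) (Or.inr ⟨(k, M.group i k, b), hw.trans (by rw [value_finish])⟩)

theorem tournament_validity (hrd : ∀ q, T.apply q rd = (q, enc q)) :
    (M.tournament rd enc V).Validity := by
  intro x σ t i a ha
  have key : ∀ t, (∀ i, ∃ j, x j = (((M.tournament rd enc V).configAt x σ t).loc i).value) ∧
      ∀ r v, ((M.tournament rd enc V).configAt x σ t).reg r = ⟨some v⟩ → ∃ j, x j = v := by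
    intro t
    induction t with
    | zero =>
      exact ⟨fun i => ⟨i, (value_finish n (x i)).symm⟩, fun r v h => by cases h⟩
    | succ t ih =>
      obtain ⟨hloc, hreg⟩ := ih
      rw [Algorithm.configAt]
      generalize (M.tournament rd enc V).configAt x σ t = c at hloc hreg
      rcases σ t with i | i
      · obtain ⟨-, hv, hr⟩ := M.after_step_spec hrd x c i
        refine ⟨fun j => ?_, fun r v h => ?_⟩
        · by_cases hji : j = i
          · subst hji
            rcases hv with hv | ⟨r, hv⟩
            · rw [hv]
              exact hloc j
            · exact hreg r _ hv
          · rw [after_step_loc_of_ne x c hji]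
            exact hloc j
        · rcases hr r v h with h | rfl
          · exact hreg r v h
          · exact hloc i
      · refine ⟨fun j => ?_, hreg⟩
        by_cases hji : j = i
        · subst hji
          exact ⟨j, by simp [Algorithm.after, tournament]⟩
        · simpa [Algorithm.after, Function.update_of_ne hji] using hloc j
  obtain ⟨j, hj⟩ := (key t).1 i
  rw [M.eq_of_next_eq_output ha] at hj
  exact ⟨j, hj⟩

theorem tournament_recoverableWaitFree (hrd : ∀ q, T.apply q rd = (q, enc q)) :
    (M.tournament rd enc V).RecoverableWaitFree := by
  intro x σ i hσ t
  by_contra! hcon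
  have hdone : ∀ s, t ≤ s → ¬ ∃ a, ((M.tournament rd enc V).configAt x σ s).loc i = done a := by
    rintro s hs ⟨a, ha⟩
    refine (hcon s hs).2 a ?_
    rw [Algorithm.Outputs, ha]
    rfl
  have hstep : ∀ s, t ≤ s → σ s = .step i →
      (((M.tournament rd enc V).configAt x σ (s + 1)).loc i).remaining <
        (((M.tournament rd enc V).configAt x σ s).loc i).remaining := by
    intro s hs hsi
    rw [Algorithm.configAt, hsi]
    exact (M.after_step_spec hrd x _ i).1.resolve_left (hdone s hs)
  have hle : ∀ s, t ≤ s → (((M.tournament rd enc V).configAt x σ (s + 1)).loc i).remaining ≤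
      (((M.tournament rd enc V).configAt x σ s).loc i).remaining := by
    intro s hs
    by_cases hsi : σ s = .step i
    · exact (hstep s hs hsi).le
    · rw [Algorithm.configAt]
      rcases he : σ s with j | j
      · rw [after_step_loc_of_ne]
        rintro rfl
        exact hsi he
      · have hij : i ≠ j := by
          rintro rfl
          exact (hcon s hs).1 he
        simp [Algorithm.after, Function.update_of_ne hij]
  have hanti : ∀ s s', t ≤ s → s ≤ s' →
      (((M.tournament rd enc V).configAt x σ s').loc i).remaining ≤
        (((M.tournament rd enc V).configAt x σ s).loc i).remaining := by
    intro s s' hs hss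
    induction s', hss using Nat.le_induction with
    | base => exact le_rfl
    | succ s' hs' ih => exact (hle s' (hs.trans hs')).trans ih
  have hbound : ∀ m s, t ≤ s →
      m ≤ (((M.tournament rd enc V).configAt x σ s).loc i).remaining := by
    intro m
    induction m with
    | zero => exact fun _ _ => Nat.zero_le _
    | succ m ih =>
      intro s hs
      obtain ⟨s', hss, hsi⟩ := hσ s
      have h1 := ih (s' + 1) (by omega)
      have h2 := hstep s' (hs.trans hss) hsi
      have h3 := hanti s s' hs hss
      omega
  -- The bound is taken at one more than the number of steps remaining at time `t`.
  exact absurd (hbound _ t le_rfl) (Nat.not_succ_le_self _)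

theorem tournament_solvesRC (henc : Function.Injective enc)
    (hrd : ∀ q, T.apply q rd = (q, enc q)) : (M.tournament rd enc V).SolvesRC :=
  ⟨M.tournament_agreement henc hrd, M.tournament_validity hrd,
    M.tournament_recoverableWaitFree hrd⟩

end Correctness

end DetObjectType.TeamScheme

theorem theorem2 (T : DetObjectType.{u}) (n : ℕ) (hread : T.IsReadable)
    (hrec : T.IsRecording n) : RCSolvable.{u, v} T n := by
  obtain ⟨rd, enc, henc, hrd⟩ := hread
  obtain ⟨M⟩ := hrec.exists_teamScheme
  exact fun V => ⟨M.tournament rd enc V, M.tournament_solvesRC henc hrd⟩
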